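/- Let $\mathcal Y=\{\mathsf N,\mathsf E,\mathsf{SW}\}=\{(0,1),(1,0),(-1,-1)\}$ (the reverse Kreweras step set). A walk of length $n$ in the quarter plane is a sequence $w_1,\dots,w_n$ of elements of $\mathcal Y$ such that for every $k\le n$ both coordinates of $w_1+\cdots+w_k$ are nonnegative; it ends at $w_1+\cdots+w_n$. Let $Q_6(x,y;t)\in\mathbb Q[x,y][[t]]$ be the series in which the coefficient of $x^iy^jt^n$ is the number of walks of length $n$ in the quarter plane ending at $(i,j)$. There is a unique power series $T\in\mathbb Q[[t]]$ with $T=t(2+T^3)$. Put $$U(x)=1-xT\left(1+\frac{T^3}{4}\right)+\frac{x^2T^2}{4}\in\mathbb Q[x][[t]];$$ it has a unique square root $\sqrt{U}\in\mathbb Q[x][[t]]$ whose constant term in $t$ is $1$. Then the generating series $Q_6(x,0;t)$ of the walks that end on the $x$-axis is given by $$2Q_6(x,0;t)=Q_6(0,0;t)+\left(\frac{-2x}{Tt}\left(1-\frac{T^2}{2x}\right)+\frac1{tx}\right)\sqrt{U}+\left(1-tx-\frac{t}{x^2}\right)x\,t^{-2},$$ where $$Q_6(0,0;t)=\frac{4T-T^4}{8t}$$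 (identities in the field of fractions of $\mathbb Q[x][[t]]$). Moreover $Q_6(x,0;t)$ is algebraic over $\mathbb Q[x,t]$, and $Q_6(x,y;t)$ is algebraic over $\mathbb Q[x,y,t]$. -/

import Mathlib

open scoped Polynomial PowerSeries

noncomputable section

/-- The walks of length `n` in the quarter plane with steps in `Y`: sequences of `n` steps
of `Y` all of whose partial sums (starting from the origin) lie in the first quadrant. -/
def quarterPlaneWalks (Y : Finset (ℤ × ℤ)) (n : ℕ) : Finset (Fin n → ℤ × ℤ) :=
  (Fintype.piFinset fun _ => Y).filter fun w =>
    ∀ k : Fin n, 0 ≤ (∑ i ∈ Finset.Iic k, w i).1 ∧ 0 ≤ (∑ i ∈ Finset.Iic k, w i).2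

/-- The end point of a walk that starts at the origin. -/
def walkEnd {n : ℕ} (w : Fin n → ℤ × ℤ) : ℤ × ℤ := ∑ i, w i

/-- The complete generating function `Q_Y(x,y;t)`, a power series in `t` whose coefficients
are polynomials in `x` (variable `0`) and `y` (variable `1`): each walk of length `n` in the
quarter plane ending at `(i,j)` contributes `x ^ i * y ^ j * t ^ n`. -/
def completeGF (Y : Finset (ℤ × ℤ)) : (MvPolynomial (Fin 2) ℚ)⟦X⟧ :=
  PowerSeries.mk fun n => ∑ w ∈ quarterPlaneWalks Y n,
    MvPolynomial.X 0 ^ (walkEnd w).1.toNat * MvPolynomial.X 1 ^ (walkEnd w).2.toNat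

/-- The end point of a walk in the quarter plane lies in the quarter plane. -/
theorem walkEnd_nonneg {Y : Finset (ℤ × ℤ)} {n : ℕ} {w : Fin n → ℤ × ℤ}
    (hw : w ∈ quarterPlaneWalks Y n) : 0 ≤ (walkEnd w).1 ∧ 0 ≤ (walkEnd w).2 := by
  cases n with
  | zero => simp [walkEnd]
  | succ m =>
    have h := (Finset.mem_filter.1 hw).2 (Fin.last m)
    have e : (Finset.Iic (Fin.last m)) = Finset.univ := by
      ext i
      simp [Fin.le_last]
    rw [e] at h
    exact h

/-- The coefficient of `x ^ i * y ^ j * t ^ n` in `Q_Y(x,y;t)` is the number of walks of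
length `n` ending at `(i,j)`. -/
theorem coeff_completeGF (Y : Finset (ℤ × ℤ)) (n : ℕ) (m : Fin 2 →₀ ℕ) :
    MvPolynomial.coeff m (PowerSeries.coeff n (completeGF Y)) =
      (((quarterPlaneWalks Y n).filter fun w => walkEnd w = ((m 0 : ℤ), (m 1 : ℤ))).card : ℚ) := by
  rw [completeGF, PowerSeries.coeff_mk, MvPolynomial.coeff_sum, Finset.card_filter,
    Nat.cast_sum]
  refine Finset.sum_congr rfl fun w hw => ?_
  obtain ⟨h1, h2⟩ := walkEnd_nonneg hw
  rw [MvPolynomial.X_pow_eq_monomial, MvPolynomial.X_pow_eq_monomial,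
    MvPolynomial.monomial_mul, MvPolynomial.coeff_monomial]
  have key : (Finsupp.single 0 (walkEnd w).1.toNat + Finsupp.single 1 (walkEnd w).2.toNat = m) ↔
      walkEnd w = ((m 0 : ℤ), (m 1 : ℤ)) := by
    constructor
    · intro h
      subst h
      ext <;> simp [h1, h2]
    · intro h
      rw [h]
      ext i
      fin_cases i <;> simp
  simp [key]

/-- The series `F(a,b;t)` obtained from `F(x,y;t)` by setting `x = a` and `y = b`. -/
def specializeXY {A : Type*} [CommRing A] [Algebra ℚ A] (a b : A)
    (F : (MvPolynomial (Fin 2) ℚ)⟦X⟧) : A⟦X⟧ :=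
  PowerSeries.map (MvPolynomial.aeval ![a, b] : MvPolynomial (Fin 2) ℚ →ₐ[ℚ] A).toRingHom F

/-- The reverse Kreweras step set `{N, E, SW}`. -/
def reverseKreweras : Finset (ℤ × ℤ) := {(0, 1), (1, 0), (-1, -1)}

/-- `Q₆(x,y;t)`. -/
def Q6 : (MvPolynomial (Fin 2) ℚ)⟦X⟧ := completeGF reverseKreweras

/-- `Q₆(x,0;t)`, a power series in `t` with coefficients in `ℚ[x]`. -/
def Q6x0 : ℚ[X]⟦X⟧ := specializeXY Polynomial.X 0 Q6

/-- `Q₆(0,0;t)`, a power series in `t`. -/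
def Q600 : ℚ⟦X⟧ := specializeXY 0 0 Q6

/-- A power series in `t` alone, seen as a power series in `t` with coefficients in `ℚ[x]`. -/
def constInX (f : ℚ⟦X⟧) : ℚ[X]⟦X⟧ := PowerSeries.map Polynomial.C f

/-- The variable `x` as an element of `ℚ[x]⟦t⟧`. -/
def xVar : ℚ[X]⟦X⟧ := PowerSeries.C Polynomial.X

/-- `U(x) = 1 - x T (1 + T³/4) + x² T²/4`. -/
def seriesU (T : ℚ⟦X⟧) : ℚ[X]⟦X⟧ :=
  1 - xVar * constInX T * (1 + (1 / 4 : ℚ) • constInX T ^ 3)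
    + (1 / 4 : ℚ) • (xVar ^ 2 * constInX T ^ 2)

/-- The field of fractions of `ℚ[x]⟦t⟧`, in which `x`, `t` and `T` are invertible. -/
abbrev SeriesField : Type := FractionRing (ℚ[X]⟦X⟧)

/-- The inclusion of `ℚ[x]⟦t⟧` into its field of fractions. -/
def toField : ℚ[X]⟦X⟧ →+* SeriesField := algebraMap (ℚ[X]⟦X⟧) SeriesField

end

/-! The proof is the kernel method followed by guess-and-check. Adding a last step to a walk, and
using the symmetry in x and y, gives (xy - t(x²y + xy² + 1)) Q(x,y) = xy - t(Q(x,0) + Q(y,0) -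
Q(0,0)) (`kernel_mul_Q6`). At the root Y = t/x + ... of the kernel this becomes Q(x,0) + Q(Y,0) -
Q(0,0) = xY/t (`X_mul_evalAt_Q6x0`).

That equation has only one solution: if D(x) + D(Y) = D(0), the lowest coefficient d of D in t
satisfies d(x) + d(0) = d(0), because Y vanishes at t = 0 (`eq_zero_of_evalAt_add_evalAt`).

So it suffices that the closed form solves it. Its rational part r(x) = (x/t² - x²/t - 1/(tx))/2
satisfies r(x) + r(Y) = xY/t on the kernel curve. Its irrational part is a multiple of (-2x² + T²x +
T)√U(x)/x, whose values at x and Y have equal squares on the curve and opposite lowest terms, hence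
cancel (`conjugate_sqrt_add_eq_zero`). Writing √U = 1 + xR removes the poles at x = 0, so that x = 0
and x = Y can be substituted; x = 0 yields Q(0,0).

Algebraicity passes from T to √U, to Q(x,0), and through the kernel equation to Q(x,y). -/

open scoped Polynomial PowerSeries

/-! ### Fixed points and substitution in formal power series. -/

namespace PowerSeries

/-- A map that is strictly contracting for the `X`-adic topology has a unique fixed point. -/
theorem existsUnique_fixedPoint {R : Type*} [CommRing R] (F : R⟦X⟧ → R⟦X⟧)
    (hF : ∀ (n : ℕ) (a b : R⟦X⟧), X ^ n ∣ a - b → X ^ (n + 1) ∣ F a - F b) :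
    ∃! f : R⟦X⟧, f = F f := by
  have eq_of_dvd : ∀ a b : R⟦X⟧, (∀ n : ℕ, X ^ n ∣ a - b) → a = b := by
    intro a b h
    ext n
    have := X_pow_dvd_iff.1 (h (n + 1)) n (Nat.lt_succ_self n)
    rwa [map_sub, sub_eq_zero] at this
  have hstep : ∀ n : ℕ, X ^ n ∣ F^[n + 1] 0 - F^[n] 0 := by
    intro n
    induction n with
    | zero => simp
    | succ n ih =>
      simp only [Function.iterate_succ_apply']
      rw [Function.iterate_succ_apply' F n] at ih
      exact hF _ _ _ ih
  have hcauchy : ∀ n k : ℕ, X ^ n ∣ F^[n + k] 0 - F^[n] 0 := by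
    intro n k
    induction k with
    | zero => simp
    | succ k ih =>
      have h := dvd_add ((pow_dvd_pow X (Nat.le_add_right n k)).trans (hstep (n + k))) ih
      simpa [add_assoc] using h
  -- The coefficient of `X ^ n` is the same in all iterates from the (n+1)-st on.
  let f : R⟦X⟧ := mk fun n => coeff n (F^[n + 1] 0)
  have hf : ∀ n : ℕ, X ^ n ∣ f - F^[n] 0 := by
    intro n
    rw [X_pow_dvd_iff]
    intro m hm
    obtain ⟨k, rfl⟩ := Nat.exists_eq_add_of_le (Nat.succ_le_of_lt hm)
    have := X_pow_dvd_iff.1 (hcauchy (m + 1) k) m (Nat.lt_succ_self m)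
    rw [map_sub, sub_eq_zero] at this ⊢
    rw [coeff_mk, ← this]
  have hfix : f = F f := eq_of_dvd _ _ fun n => by
    have h1 := hF n _ _ (hf n)
    have h2 := hf (n + 1)
    rw [Function.iterate_succ_apply'] at h2
    have h3 := dvd_sub h2 h1
    rw [sub_sub_sub_cancel_right] at h3
    exact (pow_dvd_pow X (Nat.le_succ n)).trans h3
  refine ⟨f, hfix, fun g hg => eq_of_dvd _ _ fun n => ?_⟩
  induction n with
  | zero => simp
  | succ n ih =>
    rw [hg, hfix]
    exact hF n _ _ ih

/-- The extension of a ring homomorphism `φ : R →+* S⟦X⟧` to `R⟦X⟧` that sends `X` to `X`. -/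
noncomputable def liftX {R S : Type*} [CommRing R] [CommRing S] (φ : R →+* S⟦X⟧) :
    R⟦X⟧ →+* S⟦X⟧ where
  toFun f := mk fun n => ∑ p ∈ Finset.HasAntidiagonal.antidiagonal n, coeff p.2 (φ (coeff p.1 f))
  map_zero' := by ext; simp
  map_one' := by
    ext n
    rw [coeff_mk, Finset.sum_eq_single (0, n)]
    · simp
    · rintro ⟨i, j⟩ h hne
      have : i ≠ 0 := by
        rintro rfl
        simp at h
        exact hne (by simp [h])
      simp [coeff_one, this]
    · simp
  map_add' f g := by ext; simp [Finset.sum_add_distrib]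
  map_mul' f g := by
    ext n
    simp only [coeff_mk, coeff_mul, map_sum, map_mul, Finset.sum_mul_sum]
    simp only [← Finset.sum_product', Finset.sum_sigma']
    -- Exchanging the two middle indices regroups (a+b, c+d) as (a+c, b+d); this is an involution.
    refine Finset.sum_nbij'
      (fun p => ⟨(p.2.1.1 + p.2.2.1, p.2.1.2 + p.2.2.2),
        ((p.2.1.1, p.2.2.1), (p.2.1.2, p.2.2.2))⟩)
      (fun p => ⟨(p.2.1.1 + p.2.2.1, p.2.1.2 + p.2.2.2),
        ((p.2.1.1, p.2.2.1), (p.2.1.2, p.2.2.2))⟩) ?_ ?_ ?_ ?_ ?_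
    · rintro ⟨⟨a, b⟩, ⟨c, d⟩, e, f⟩ h
      simp at h ⊢
      omega
    · rintro ⟨⟨a, b⟩, ⟨c, d⟩, e, f⟩ h
      simp at h ⊢
      omega
    · rintro ⟨⟨a, b⟩, ⟨c, d⟩, e, f⟩ h
      simp at h ⊢
      omega
    · rintro ⟨⟨a, b⟩, ⟨c, d⟩, e, f⟩ h
      simp at h ⊢
      omega
    · rintro ⟨⟨a, b⟩, ⟨c, d⟩, e, f⟩ h
      simp

section liftX

variable {R S : Type*} [CommRing R] [CommRing S] (φ : R →+* S⟦X⟧)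

/-- The sum is finite for every φ, so the images of the coefficients need no convergence condition.
Later x is sent both to `C x`, which has a nonzero constant term, and to the kernel root Y. -/
theorem coeff_liftX (n : ℕ) (f : R⟦X⟧) :
    coeff n (liftX φ f) = ∑ p ∈ Finset.HasAntidiagonal.antidiagonal n, coeff p.2 (φ (coeff p.1 f)) := by
  simp only [liftX, RingHom.coe_mk, MonoidHom.coe_mk, OneHom.coe_mk, coeff_mk]

theorem constantCoeff_liftX (f : R⟦X⟧) :
    constantCoeff (liftX φ f) = constantCoeff (φ (constantCoeff f)) := by
  rw [← coeff_zero_eq_constantCoeff_apply, coeff_liftX]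
  simp

theorem liftX_C (r : R) : liftX φ (C r) = φ r := by
  ext n
  rw [coeff_liftX, Finset.sum_eq_single (0, n)]
  · simp
  · rintro ⟨i, j⟩ h hne
    have : i ≠ 0 := by
      rintro rfl
      simp at h
      exact hne (by simp [h])
    simp [coeff_C, this]
  · simp

theorem liftX_map {Q : Type*} [CommRing Q] (ψ : Q →+* R) (f : Q⟦X⟧) :
    liftX φ (map ψ f) = liftX (φ.comp ψ) f := by
  ext n
  simp [coeff_liftX]

theorem liftX_C_comp (χ : R →+* S) (f : R⟦X⟧) : liftX (C.comp χ) f = map χ f := by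
  ext n
  rw [coeff_liftX, Finset.sum_eq_single (n, 0)]
  · simp
  · rintro ⟨i, j⟩ h hne
    have : j ≠ 0 := by
      rintro rfl
      simp at h
      exact hne (by simp [h])
    simp [coeff_C, this]
  · simp

theorem liftX_X : liftX φ X = X := by
  -- `X` already lives over ℤ, where φ can only be the constant embedding.
  have h : (X : R⟦X⟧) = map (Int.castRingHom R) X := by simp
  rw [h, liftX_map, Subsingleton.elim (φ.comp (Int.castRingHom R)) (C.comp (Int.castRingHom S)),
    liftX_C_comp, map_X]

end liftX

end PowerSeries

/-! ### Walks built step by step, and the kernel equation. -/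

/-- A quarter plane walk of length `n + 1` is a quarter plane walk of length `n` followed by a
step that stays in the quarter plane. -/
theorem sum_quarterPlaneWalks_succ {M : Type*} [AddCommMonoid M] (Y : Finset (ℤ × ℤ)) (n : ℕ)
    (g : ℤ × ℤ → M) :
    ∑ w ∈ quarterPlaneWalks Y (n + 1), g (walkEnd w) =
      ∑ w ∈ quarterPlaneWalks Y n, ∑ s ∈ Y,
        if 0 ≤ (walkEnd w + s).1 ∧ 0 ≤ (walkEnd w + s).2 then g (walkEnd w + s) else 0 := by
  rw [← Finset.sum_product', ← Finset.sum_filter]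
  have hIic : ∀ (w : Fin (n + 1) → ℤ × ℤ) (k : Fin n),
      ∑ i ∈ Finset.Iic k.castSucc, w i = ∑ i ∈ Finset.Iic k, (Fin.init w : Fin n → ℤ × ℤ) i :=
    fun w k => Fin.sum_Iic_castSucc w k
  have hlast : Finset.Iic (Fin.last n) = Finset.univ := by
    ext i
    simp [Fin.le_last]
  have hend : ∀ w : Fin (n + 1) → ℤ × ℤ,
      walkEnd w = walkEnd (Fin.init w : Fin n → ℤ × ℤ) + w (Fin.last n) :=
    fun w => Fin.sum_univ_castSucc w
  have hmem : ∀ w : Fin (n + 1) → ℤ × ℤ, w ∈ quarterPlaneWalks Y (n + 1) ↔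
      ((Fin.init w : Fin n → ℤ × ℤ) ∈ quarterPlaneWalks Y n ∧ w (Fin.last n) ∈ Y) ∧
        0 ≤ (walkEnd w).1 ∧ 0 ≤ (walkEnd w).2 := by
    intro w
    simp only [quarterPlaneWalks, Finset.mem_filter, Fintype.mem_piFinset, Fin.forall_fin_succ',
      hIic, hlast]
    simp only [Fin.init, walkEnd]
    tauto
  refine Finset.sum_nbij' (fun w => (Fin.init w, w (Fin.last n)))
    (fun p => (Fin.snoc p.1 p.2 : Fin (n + 1) → ℤ × ℤ)) ?_ ?_ ?_ ?_ ?_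
  · intro w hw
    rw [hmem] at hw
    simpa [hend] using hw
  · rintro ⟨w, s⟩ hw
    rw [hmem, hend]
    simpa using hw
  · intro w _
    simp
  · rintro ⟨w, s⟩ _
    simp
  · intro w _
    simp only [hend w]

section ReverseKreweras

open MvPolynomial

/-- The polynomial recording the end points of the walks of length `n`. -/
theorem coeff_Q6 (n : ℕ) : PowerSeries.coeff n Q6 =
    ∑ w ∈ quarterPlaneWalks reverseKreweras n,
      X 0 ^ (walkEnd w).1.toNat * X 1 ^ (walkEnd w).2.toNat := by
  rw [Q6, completeGF, PowerSeries.coeff_mk]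

theorem coeff_zero_Q6 : PowerSeries.coeff 0 Q6 = 1 := by
  rw [coeff_Q6]
  simp [quarterPlaneWalks, walkEnd]

/-- The step-by-step recurrence for reverse Kreweras walks. -/
theorem coeff_succ_Q6 (n : ℕ) :
    X 0 * X 1 * PowerSeries.coeff (n + 1) Q6 =
      (X 0 ^ 2 * X 1 + X 0 * X 1 ^ 2 + 1) * PowerSeries.coeff n Q6
        - aeval ![X 0, (0 : MvPolynomial (Fin 2) ℚ)] (PowerSeries.coeff n Q6)
        - aeval ![(0 : MvPolynomial (Fin 2) ℚ), X 1] (PowerSeries.coeff n Q6)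
        + aeval ![(0 : MvPolynomial (Fin 2) ℚ), 0] (PowerSeries.coeff n Q6) := by
  rw [coeff_Q6, coeff_Q6,
    sum_quarterPlaneWalks_succ reverseKreweras n fun p => X 0 ^ p.1.toNat * X 1 ^ p.2.toNat]
  simp only [map_sum, Finset.mul_sum, ← Finset.sum_sub_distrib, ← Finset.sum_add_distrib]
  refine Finset.sum_congr rfl fun w hw => ?_
  obtain ⟨h1, h2⟩ := walkEnd_nonneg hw
  generalize walkEnd w = e at h1 h2
  obtain ⟨i, j⟩ := e
  lift i to ℕ using h1
  lift j to ℕ using h2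
  rw [reverseKreweras, Finset.sum_insert (by decide), Finset.sum_insert (by decide),
    Finset.sum_singleton]
  have hj : ((j : ℤ) + 1).toNat = j + 1 := by omega
  have hi : ((i : ℤ) + 1).toNat = i + 1 := by omega
  have hj0 : (0 : ℤ) ≤ (j : ℤ) + 1 := by omega
  have hi0 : (0 : ℤ) ≤ (i : ℤ) + 1 := by omega
  simp only [Prod.mk_add_mk, add_zero, Int.toNat_natCast, hj, hi, hj0, hi0, Int.natCast_nonneg,
    and_self, if_true, map_mul, map_pow, aeval_X, Matrix.cons_val_zero, Matrix.cons_val_one]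
  -- The step SW is forbidden exactly when i = 0 or j = 0; the three evaluations at 0 remove it by
  -- inclusion-exclusion.
  rcases i with _ | i <;> rcases j with _ | j
  · simp
    ring
  · simp
    ring
  · simp
    ring
  · have e1 : (((i + 1 : ℕ) : ℤ) + -1).toNat = i := by omega
    have e2 : (((j + 1 : ℕ) : ℤ) + -1).toNat = j := by omega
    have e3 : (0 : ℤ) ≤ ((i + 1 : ℕ) : ℤ) + -1 ∧ (0 : ℤ) ≤ ((j + 1 : ℕ) : ℤ) + -1 := by omega
    rw [if_pos e3, e1, e2]
    simp
    ring

/-- Exchanging the two coordinates preserves the reverse Kreweras walks. -/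
theorem aeval_swap_coeff_Q6 (n : ℕ) :
    aeval ![X 1, (X 0 : MvPolynomial (Fin 2) ℚ)] (PowerSeries.coeff n Q6) =
      PowerSeries.coeff n Q6 := by
  -- The recurrence is symmetric in the two variables, and its factor xy can be cancelled.
  induction n with
  | zero => simp [coeff_zero_Q6]
  | succ n ih =>
    have hne : (X 0 * X 1 : MvPolynomial (Fin 2) ℚ) ≠ 0 := mul_ne_zero (X_ne_zero 0) (X_ne_zero 1)
    refine mul_left_cancel₀ hne ?_
    have hcomp : ∀ (a b : MvPolynomial (Fin 2) ℚ) (p : MvPolynomial (Fin 2) ℚ),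
        aeval ![X 1, (X 0 : MvPolynomial (Fin 2) ℚ)] (aeval ![a, b] p) =
          aeval ![aeval ![X 1, (X 0 : MvPolynomial (Fin 2) ℚ)] a,
            aeval ![X 1, (X 0 : MvPolynomial (Fin 2) ℚ)] b] p := by
      intro a b p
      rw [← AlgHom.comp_apply]
      congr 1
      ext i
      fin_cases i <;> simp
    have hswap : ∀ a b : MvPolynomial (Fin 2) ℚ,
        aeval ![b, a] (PowerSeries.coeff n Q6) = aeval ![a, b] (PowerSeries.coeff n Q6) := by
      intro a b
      conv_rhs => rw [← ih]
      rw [← AlgHom.comp_apply]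
      congr 1
      ext i
      fin_cases i <;> simp
    have h := congrArg (aeval ![X 1, (X 0 : MvPolynomial (Fin 2) ℚ)]) (coeff_succ_Q6 n)
    simp only [map_add, map_sub, map_mul, map_pow, map_one, hcomp, ih, aeval_X, map_zero,
      Matrix.cons_val_zero, Matrix.cons_val_one] at h
    rw [hswap (X 0) 0, hswap 0 (X 1)] at h
    linear_combination h - coeff_succ_Q6 n

/-- The kernel equation satisfied by `Q₆`. -/
theorem kernel_mul_Q6 :
    (PowerSeries.C (X 0 * X 1) -
        PowerSeries.X * PowerSeries.C (X 0 ^ 2 * X 1 + X 0 * X 1 ^ 2 + 1)) * Q6 =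
      PowerSeries.C (X 0 * X 1) -
        PowerSeries.X *
          (PowerSeries.map
              (Polynomial.aeval (X 0 : MvPolynomial (Fin 2) ℚ) : ℚ[X] →ₐ[ℚ] _).toRingHom Q6x0 +
            PowerSeries.map
              (Polynomial.aeval (X 1 : MvPolynomial (Fin 2) ℚ) : ℚ[X] →ₐ[ℚ] _).toRingHom Q6x0 -
            PowerSeries.map MvPolynomial.C Q600) := by
  have hx : ∀ (n : ℕ) (a : MvPolynomial (Fin 2) ℚ), Polynomial.aeval a
      (aeval ![Polynomial.X, (0 : ℚ[X])] (PowerSeries.coeff n Q6)) =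
        aeval ![a, 0] (PowerSeries.coeff n Q6) := by
    intro n a
    rw [← AlgHom.restrictScalars_apply ℚ (Polynomial.aeval a), ← AlgHom.comp_apply]
    congr 1
    ext i
    fin_cases i <;> simp
  have h0 : ∀ n : ℕ, (C (aeval ![(0 : ℚ), 0] (PowerSeries.coeff n Q6)) :
      MvPolynomial (Fin 2) ℚ) = aeval ![0, 0] (PowerSeries.coeff n Q6) := by
    intro n
    rw [← MvPolynomial.algebraMap_eq, ← Algebra.ofId_apply, ← AlgHom.comp_apply]
    congr 1
    ext i
    fin_cases i <;> simp
  -- Symmetry replaces Q(0,y) by Q(y,0), leaving a single unknown series in one catalytic variable.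
  have hsw : ∀ n : ℕ, aeval ![X 1, (0 : MvPolynomial (Fin 2) ℚ)] (PowerSeries.coeff n Q6) =
      aeval ![0, X 1] (PowerSeries.coeff n Q6) := by
    intro n
    conv_lhs => rw [← aeval_swap_coeff_Q6 n]
    rw [← AlgHom.comp_apply]
    congr 1
    ext i
    fin_cases i <;> simp
  ext1 n
  cases n with
  | zero =>
    have h : PowerSeries.constantCoeff Q6 = 1 := by
      rw [← PowerSeries.coeff_zero_eq_constantCoeff_apply, coeff_zero_Q6]
    simp [sub_mul, mul_assoc, h]
  | succ n =>
    have h := coeff_succ_Q6 n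
    simp only [sub_mul, mul_assoc, map_sub, PowerSeries.coeff_succ_X_mul,
      PowerSeries.coeff_C_mul]
    simp only [map_add, PowerSeries.coeff_map, Q6x0, Q600, specializeXY,
      AlgHom.toRingHom_eq_coe, RingHom.coe_coe, hx, h0, hsw, PowerSeries.coeff_C,
      Nat.succ_ne_zero, if_false]
    linear_combination h

end ReverseKreweras

/-! ### The series T, Y and √U, and evaluation at Y. -/

section Series

open PowerSeries

/-- `T = t(2 + T³)` has a unique power series solution. -/
theorem existsUnique_cubic_series : ∃! T : ℚ⟦X⟧, T = X * (2 + T ^ 3) := by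
  refine existsUnique_fixedPoint (fun T => X * (2 + T ^ 3)) fun n a b h => ?_
  have e : X * (2 + a ^ 3) - X * (2 + b ^ 3) = (a - b) * X * (a ^ 2 + a * b + b ^ 2) := by ring
  rw [e, pow_succ]
  exact (mul_dvd_mul_right h X).mul_right _

/-- The root of the kernel `xy - t(x²y + xy² + 1)` that is a power series in `t` without
constant term. -/
theorem exists_kernel_root {K : Type*} [Field K] {x : K} (hx : x ≠ 0) :
    ∃ Y : K⟦X⟧, C x * Y = X * (C x ^ 2 * Y + C x * Y ^ 2 + 1) ∧
      constantCoeff Y = 0 ∧ coeff 1 Y = x⁻¹ := by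
  obtain ⟨Y, hY, -⟩ := existsUnique_fixedPoint
    (fun Y : K⟦X⟧ => X * (C x⁻¹ + C x * Y + Y ^ 2)) fun n a b h => by
      have e : X * (C x⁻¹ + C x * a + a ^ 2) - X * (C x⁻¹ + C x * b + b ^ 2) =
        (a - b) * X * (C x + a + b) := by ring
      rw [e, pow_succ]
      exact (mul_dvd_mul_right h X).mul_right _
  have hinv : (C x * C x⁻¹ : K⟦X⟧) = 1 := by rw [← map_mul, mul_inv_cancel₀ hx, map_one]
  have h0 : constantCoeff Y = 0 := by rw [hY]; simp
  refine ⟨Y, ?_, h0, ?_⟩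
  · linear_combination C x * hY + X * hinv
  · rw [hY, show (1 : ℕ) = 0 + 1 from rfl, coeff_succ_X_mul]
    simp [h0]

theorem constInX_eq_X_mul {T : ℚ⟦X⟧} (hT : T = X * (2 + T ^ 3)) :
    constInX T = X * (2 + constInX T ^ 3) := by
  conv_lhs => rw [hT]
  simp [constInX, map_ofNat]

theorem seriesU_eq (T : ℚ⟦X⟧) : seriesU T = 1 - xVar * constInX T *
    (1 + C (Polynomial.C (1 / 4)) * constInX T ^ 3) +
      C (Polynomial.C (1 / 4)) * (xVar ^ 2 * constInX T ^ 2) := by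
  have h : ∀ f : ℚ[X]⟦X⟧, (1 / 4 : ℚ) • f = C (Polynomial.C (1 / 4)) * f := by
    intro f
    ext1 n
    rw [coeff_C_mul, ← Polynomial.smul_eq_C_mul]
    rfl
  rw [seriesU, h, h]

theorem four_mul_seriesU (T : ℚ⟦X⟧) : 4 * seriesU T =
    4 - xVar * constInX T * (4 + constInX T ^ 3) + xVar ^ 2 * constInX T ^ 2 := by
  have h : (4 * C (Polynomial.C (1 / 4)) : ℚ[X]⟦X⟧) = 1 := by
    have : (4 : ℚ[X]⟦X⟧) = C (Polynomial.C 4) := by rw [map_ofNat, map_ofNat]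
    rw [this, ← map_mul, ← map_mul]
    norm_num
  rw [seriesU_eq]
  linear_combination (xVar ^ 2 * constInX T ^ 2 - xVar * constInX T * constInX T ^ 3) * h

/-- The square root of `U(x)` has the form `1 + x R`. -/
theorem exists_sqrt_seriesU {T : ℚ⟦X⟧} (hT : T = X * (2 + T ^ 3)) :
    ∃ R : ℚ[X]⟦X⟧, (1 + xVar * R) ^ 2 = seriesU T ∧ constantCoeff (1 + xVar * R) = 1 ∧
      4 * (2 * R + xVar * R ^ 2) =
        xVar * constInX T ^ 2 - constInX T * (4 + constInX T ^ 3) := by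
  set τ := constInX T with hτ
  have hτX : τ = X * (2 + τ ^ 3) := constInX_eq_X_mul hT
  have h8 : (8 * C (Polynomial.C (1 / 8)) : ℚ[X]⟦X⟧) = 1 := by
    have : (8 : ℚ[X]⟦X⟧) = C (Polynomial.C 8) := by rw [map_ofNat, map_ofNat]
    rw [this, ← map_mul, ← map_mul]
    norm_num
  set c : ℚ[X]⟦X⟧ := C (Polynomial.C (1 / 8))
  -- With R = t r and τ = t(2 + τ³), the quadratic equation for R can be divided by 8t; the r² term
  -- keeps a factor t, which makes the map contracting.
  obtain ⟨r, hr, -⟩ := existsUnique_fixedPoint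
    (fun r : ℚ[X]⟦X⟧ => c * ((2 + τ ^ 3) * (xVar * τ - (4 + τ ^ 3)) - 4 * xVar * X * r ^ 2))
    fun n a b h => by
      have e : c * ((2 + τ ^ 3) * (xVar * τ - (4 + τ ^ 3)) - 4 * xVar * X * a ^ 2) -
        c * ((2 + τ ^ 3) * (xVar * τ - (4 + τ ^ 3)) - 4 * xVar * X * b ^ 2) =
          (a - b) * X * (-4 * c * xVar * (a + b)) := by ring
      rw [e, pow_succ]
      exact (mul_dvd_mul_right h X).mul_right _
  have hR : 4 * (2 * (X * r) + xVar * (X * r) ^ 2) = xVar * τ ^ 2 - τ * (4 + τ ^ 3) := by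
    linear_combination 8 * X * hr +
      X * ((2 + τ ^ 3) * (xVar * τ - (4 + τ ^ 3)) - 4 * xVar * X * r ^ 2) * h8 -
      (xVar * τ - (4 + τ ^ 3)) * hτX
  refine ⟨X * r, ?_, by simp, hR⟩
  have h4 : (4 : ℚ[X]⟦X⟧) ≠ 0 := by
    intro h
    have h1 : (1 : ℚ[X]⟦X⟧) = 0 := by linear_combination 2 * c * h - h8
    exact one_ne_zero h1
  refine mul_left_cancel₀ h4 ?_
  rw [four_mul_seriesU]
  linear_combination xVar * hR

/-- A square root is determined by its constant term, if this is `1`. -/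
theorem eq_of_sq_eq_sq_of_constantCoeff {S S₂ : ℚ[X]⟦X⟧} (h : S ^ 2 = S₂ ^ 2)
    (hS : constantCoeff S = 1) (hS₂ : constantCoeff S₂ = 1) : S = S₂ := by
  rcases sq_eq_sq_iff_eq_or_eq_neg.1 h with h | h
  · exact h
  · have := congrArg constantCoeff h
    rw [map_neg, hS, hS₂] at this
    have h2 := congrArg (Polynomial.eval 0) this
    norm_num at h2

/-- Evaluation at the root `Y` of the kernel: `f(x;t) ↦ f(Y;t)`. -/
noncomputable def evalAt {K : Type*} [Field K] [Algebra ℚ K] (Y : K⟦X⟧) : ℚ[X]⟦X⟧ →+* K⟦X⟧ :=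
  liftX (Polynomial.aeval Y : ℚ[X] →ₐ[ℚ] K⟦X⟧).toRingHom

theorem evalAt_constInX {K : Type*} [Field K] [Algebra ℚ K] (Y : K⟦X⟧) (f : ℚ⟦X⟧) :
    evalAt Y (constInX f) = map (algebraMap ℚ K) f := by
  rw [evalAt, constInX, liftX_map, ← liftX_C_comp]
  congr 2
  exact Subsingleton.elim (α := ℚ →+* K⟦X⟧) _ _

theorem evalAt_xVar {K : Type*} [Field K] [Algebra ℚ K] (Y : K⟦X⟧) : evalAt Y xVar = Y := by
  rw [evalAt, xVar, liftX_C]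
  simp

theorem evalAt_X {K : Type*} [Field K] [Algebra ℚ K] (Y : K⟦X⟧) : evalAt Y X = X := liftX_X _

theorem constantCoeff_evalAt {K : Type*} [Field K] [Algebra ℚ K] (Y : K⟦X⟧) (f : ℚ[X]⟦X⟧) :
    constantCoeff (evalAt Y f) = Polynomial.aeval (constantCoeff Y) (constantCoeff f) := by
  rw [evalAt, constantCoeff_liftX]
  induction constantCoeff f using Polynomial.induction_on' with
  | add p q hp hq => simpa using congrArg₂ (· + ·) hp hq
  | monomial n a =>
    rw [← Polynomial.C_mul_X_pow_eq_monomial]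
    simp only [AlgHom.toRingHom_eq_coe, RingHom.coe_coe, map_mul, map_pow, Polynomial.aeval_X,
      Polynomial.aeval_C]
    congr 1

theorem evalAt_C_eq_map {K : Type*} [Field K] [Algebra ℚ K] (a : K) (f : ℚ[X]⟦X⟧) :
    evalAt (C a) f = map (Polynomial.aeval a : ℚ[X] →ₐ[ℚ] K).toRingHom f := by
  rw [evalAt, ← liftX_C_comp]
  congr 2
  refine Polynomial.ringHom_ext' (Subsingleton.elim (α := ℚ →+* K⟦X⟧) _ _) ?_
  simp

/-- A series `D(x;t)` with `D(x) + D(Y) = D(0)` vanishes, if `Y` has no constant term. -/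
theorem eq_zero_of_evalAt_add_evalAt {K : Type*} [Field K] [Algebra ℚ K] {x : K}
    (hx : Function.Injective (Polynomial.aeval x : ℚ[X] →ₐ[ℚ] K)) {Y : K⟦X⟧}
    (hY : constantCoeff Y = 0) {D : ℚ[X]⟦X⟧}
    (h : evalAt (C x) D + evalAt Y D = evalAt 0 D) : D = 0 := by
  by_contra hD
  -- Both evaluations fix t, so the exact power of t in D can be cancelled before setting t = 0.
  obtain ⟨E, hE⟩ := X_pow_order_dvd (φ := D)
  rw [hE] at h
  simp only [map_mul, map_pow, evalAt_X, ← mul_add] at h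
  have hmap := congrArg constantCoeff (mul_left_cancel₀ (pow_ne_zero _ X_ne_zero) h)
  simp only [map_add, constantCoeff_evalAt, hY, map_zero, constantCoeff_C] at hmap
  have h0 : constantCoeff E = 0 := hx (by rw [map_zero]; exact add_eq_right.1 hmap)
  obtain ⟨F, hF⟩ := X_dvd_iff.2 h0
  refine coeff_order hD (X_pow_dvd_iff.1 ⟨F, ?_⟩ _ (Nat.lt_succ_self _))
  rw [Nat.succ_eq_add_one, pow_succ, mul_assoc, ← hF, ← hE]

end Series

/-! ### The closed forms of Q(x,0) and Q(0,0). -/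

section ClosedForm

open PowerSeries

theorem map_evalRingHom_Q6x0 : map (Polynomial.evalRingHom 0) Q6x0 = Q600 := by
  ext1 n
  simp only [Q6x0, Q600, specializeXY, coeff_map, AlgHom.toRingHom_eq_coe, RingHom.coe_coe]
  rw [Polynomial.coe_evalRingHom, ← Polynomial.coe_aeval_eq_eval, ← AlgHom.comp_apply]
  congr 1
  ext i
  fin_cases i <;> simp

theorem map_evalRingHom_constInX (f : ℚ⟦X⟧) :
    map (Polynomial.evalRingHom 0) (constInX f) = f := by
  ext1 n
  simp [constInX]

theorem map_evalRingHom_xVar : map (Polynomial.evalRingHom 0) xVar = 0 := by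
  simp [xVar]

theorem evalAt_zero {K : Type*} [Field K] [Algebra ℚ K] (f : ℚ[X]⟦X⟧) :
    evalAt (0 : K⟦X⟧) f = map (algebraMap ℚ K) (map (Polynomial.evalRingHom 0) f) := by
  rw [← map_zero (C : K →+* K⟦X⟧), evalAt_C_eq_map, ← RingHom.comp_apply, ← map_comp]
  congr 2
  refine Polynomial.ringHom_ext' (Subsingleton.elim (α := ℚ →+* K) _ _) ?_
  simp

/-- The kernel equation at a root of the kernel. -/
theorem X_mul_evalAt_Q6x0 {K : Type*} [Field K] [Algebra ℚ K] {x : K} {Y : K⟦X⟧}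
    (hY : C x * Y = X * (C x ^ 2 * Y + C x * Y ^ 2 + 1)) :
    X * (evalAt (C x) Q6x0 + evalAt Y Q6x0 - evalAt 0 Q6x0) = C x * Y := by
  let φ : MvPolynomial (Fin 2) ℚ →ₐ[ℚ] K⟦X⟧ := MvPolynomial.aeval ![C x, Y]
  have h := congrArg (liftX φ.toRingHom) kernel_mul_Q6
  have h0 : liftX φ.toRingHom (map (Polynomial.aeval
      (MvPolynomial.X 0 : MvPolynomial (Fin 2) ℚ) : ℚ[X] →ₐ[ℚ] _).toRingHom Q6x0) =
      evalAt (C x) Q6x0 := by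
    rw [liftX_map, evalAt]
    congr 2
    refine Polynomial.ringHom_ext' (Subsingleton.elim (α := ℚ →+* K⟦X⟧) _ _) ?_
    simp [φ]
  have h1 : liftX φ.toRingHom (map (Polynomial.aeval
      (MvPolynomial.X 1 : MvPolynomial (Fin 2) ℚ) : ℚ[X] →ₐ[ℚ] _).toRingHom Q6x0) =
      evalAt Y Q6x0 := by
    rw [liftX_map, evalAt]
    congr 2
    refine Polynomial.ringHom_ext' (Subsingleton.elim (α := ℚ →+* K⟦X⟧) _ _) ?_
    simp [φ]
  have h2 : liftX φ.toRingHom (map MvPolynomial.C Q600) = evalAt 0 Q6x0 := by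
    rw [liftX_map, evalAt_zero, map_evalRingHom_Q6x0, ← liftX_C_comp]
    congr 2
    exact Subsingleton.elim (α := ℚ →+* K⟦X⟧) _ _
  have hφ0 : φ (MvPolynomial.X 0) = C x := by simp [φ]
  have hφ1 : φ (MvPolynomial.X 1) = Y := by simp [φ]
  rw [map_mul (liftX _), map_sub (liftX _), map_sub (liftX _), map_mul (liftX _) X,
    map_mul (liftX _) X, map_sub (liftX _), map_add (liftX _), h0, h1, h2, liftX_X, liftX_C,
    liftX_C] at h
  simp only [AlgHom.toRingHom_eq_coe, RingHom.coe_coe, map_add, map_mul, map_pow, map_one,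
    hφ0, hφ1] at h
  linear_combination h - liftX (φ : MvPolynomial (Fin 2) ℚ →+* K⟦X⟧) Q6 * hY

/-- The two conjugate values of `(-2x² + T²x + T)√U / x` at a point of the kernel curve are
opposite. -/
theorem conjugate_sqrt_add_eq_zero {K : Type*} [Field K] [CharZero K] {x : K} (hx : x ≠ 0)
    {Y w a b : K⟦X⟧} (hw : w = X * (2 + w ^ 3))
    (hY : C x * Y = X * (C x ^ 2 * Y + C x * Y ^ 2 + 1))
    (hY0 : constantCoeff Y = 0) (hY1 : coeff 1 Y = x⁻¹)
    (ha : 4 * a ^ 2 = 4 - C x * w * (4 + w ^ 3) + C x ^ 2 * w ^ 2)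
    (hb : 4 * b ^ 2 = 4 - Y * w * (4 + w ^ 3) + Y ^ 2 * w ^ 2)
    (ha0 : constantCoeff a = 1) (hb0 : constantCoeff b = 1) :
    2 * (Y * (-2 * C x ^ 2 + w ^ 2 * C x + w) * a) +
      2 * (C x * (-2 * Y ^ 2 + w ^ 2 * Y + w) * b) = 0 := by
  set u : K⟦X⟧ := C x with hu
  -- The kernel relation with t eliminated through w = t(2 + w³).
  have hk : (2 + w ^ 3) * (u * Y) = w * (u ^ 2 * Y + u * Y ^ 2 + 1) := by
    linear_combination (2 + w ^ 3) * hY - (u ^ 2 * Y + u * Y ^ 2 + 1) * hw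
  -- The long cofactor is the quotient by the kernel of the difference of the squares, as
  -- polynomials in u, Y and w.
  have hsq : (2 * (Y * (-2 * u ^ 2 + w ^ 2 * u + w) * a)) ^ 2 =
      (2 * (u * (-2 * Y ^ 2 + w ^ 2 * Y + w) * b)) ^ 2 := by
    linear_combination (Y * (-2 * u ^ 2 + w ^ 2 * u + w)) ^ 2 * ha -
      (u * (-2 * Y ^ 2 + w ^ 2 * Y + w)) ^ 2 * hb +
      (4 * Y ^ 4 * u * w - 4 * Y ^ 3 * u ^ 2 * w - 4 * Y ^ 3 * u * w ^ 3 - 8 * Y ^ 3 * u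
        + 4 * Y ^ 2 * u ^ 3 * w + Y ^ 2 * u * w ^ 5 - 4 * Y ^ 2 * u * w ^ 2 - 4 * Y ^ 2 * w
        - 4 * Y * u ^ 4 * w + 4 * Y * u ^ 3 * w ^ 3 + 8 * Y * u ^ 3 - Y * u ^ 2 * w ^ 5
        + 4 * Y * u ^ 2 * w ^ 2 + 4 * u ^ 2 * w) * hk
  rcases sq_eq_sq_iff_eq_or_eq_neg.1 hsq with h | h
  · exfalso
    -- Y and w are both divisible by t. After division by t the constant terms of the two sides are
    -- -4x and 4x, so they cannot be equal.
    obtain ⟨Z, hZ⟩ := X_dvd_iff.2 hY0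
    have hZ0 : constantCoeff Z = x⁻¹ := by
      rw [← hY1, hZ, show (1 : ℕ) = 0 + 1 from rfl, coeff_succ_X_mul,
        coeff_zero_eq_constantCoeff_apply]
    have hw0 : constantCoeff w = 0 := by rw [hw]; simp
    have hmap : X * (2 * (Z * (-2 * u ^ 2 + w ^ 2 * u + w) * a)) =
        X * (2 * (u * (-2 * Z * Y + (2 + w ^ 3) * w * Y + (2 + w ^ 3)) * b)) := by
      linear_combination h - 2 * (-2 * u ^ 2 + w ^ 2 * u + w) * a * hZ -
        4 * u * Y * b * hZ + 2 * u * b * (w * Y + 1) * hw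
    have hcoeff := congrArg constantCoeff (mul_left_cancel₀ X_ne_zero hmap)
    simp only [map_mul, map_add, map_pow, map_neg, map_ofNat, hZ0, hw0, hY0, ha0, hb0, hu,
      constantCoeff_C] at hcoeff
    have h8 : (8 : K) * x = 0 := by
      linear_combination -hcoeff - 4 * x * inv_mul_cancel₀ hx
    simp [hx] at h8
  · rw [h, neg_add_cancel]

/-- The closed form of `Q₆(x,0;t)`, without denominators. -/
theorem Q6x0_closed_form {T : ℚ⟦X⟧} (hT : T = X * (2 + T ^ 3)) {R : ℚ[X]⟦X⟧}
    (hS : (1 + xVar * R) ^ 2 = seriesU T) (hS0 : constantCoeff (1 + xVar * R) = 1)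
    (hR : 4 * (2 * R + xVar * R ^ 2) =
        xVar * constInX T ^ 2 - constInX T * (4 + constInX T ^ 3)) :
    16 * X * constInX T * Q6x0 = constInX T ^ 2 * (4 - constInX T ^ 3) +
      8 * (-2 * xVar + constInX T ^ 2) * (1 + xVar * R) + 8 * constInX T * R +
      8 * (2 + constInX T ^ 3) * xVar - 8 * constInX T * xVar ^ 2 := by
  have hinj : Function.Injective (Polynomial.aeval (RatFunc.X : RatFunc ℚ) : ℚ[X] →ₐ[ℚ] _) := by
    have h : ((Polynomial.aeval (RatFunc.X : RatFunc ℚ) : ℚ[X] →ₐ[ℚ] _) : ℚ[X] →+* RatFunc ℚ) =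
        algebraMap ℚ[X] (RatFunc ℚ) := by
      refine Polynomial.ringHom_ext' (Subsingleton.elim (α := ℚ →+* RatFunc ℚ) _ _) ?_
      simp
    intro p q hpq
    refine RatFunc.algebraMap_injective ℚ ?_
    rw [← h]
    exact hpq
  have hx : (RatFunc.X : RatFunc ℚ) ≠ 0 := RatFunc.X_ne_zero
  obtain ⟨Y, hY, hY0, hY1⟩ := exists_kernel_root hx
  have hq := X_mul_evalAt_Q6x0 hY
  -- Q(0,0) need not be known here: the value at 0 is part of the uniqueness equation.
  refine sub_eq_zero.1 (eq_zero_of_evalAt_add_evalAt hinj hY0 ?_)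
  have hxVar0 : evalAt (0 : (RatFunc ℚ)⟦X⟧) xVar = 0 := evalAt_xVar 0
  set w := map (algebraMap ℚ (RatFunc ℚ)) T with hwdef
  have hw : w = X * (2 + w ^ 3) := by
    rw [hwdef]
    conv_lhs => rw [hT]
    simp [map_ofNat]
  have hU4 := four_mul_seriesU T
  rw [← hS] at hU4
  have ha := congrArg (evalAt (C (RatFunc.X : RatFunc ℚ))) hU4
  have hb := congrArg (evalAt Y) hU4
  have hr := congrArg (evalAt (0 : (RatFunc ℚ)⟦X⟧)) hR
  have ha0 := constantCoeff_evalAt (C (RatFunc.X : RatFunc ℚ)) (1 + xVar * R)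
  have hb0 := constantCoeff_evalAt Y (1 + xVar * R)
  rw [hS0, map_one] at ha0 hb0
  simp only [map_mul, map_add, map_sub, map_pow, map_neg, map_ofNat, map_one, evalAt_xVar,
    evalAt_constInX, evalAt_X, hxVar0, ← hwdef] at ha hb hr ha0 hb0 ⊢
  have hab := conjugate_sqrt_add_eq_zero hx hw hY hY0 hY1 ha hb
    (by simpa only [map_mul, map_add, map_one] using ha0)
    (by simpa only [map_mul, map_add, map_one] using hb0)
  set u : (RatFunc ℚ)⟦X⟧ := C RatFunc.X with hu
  have hk : (2 + w ^ 3) * (u * Y) = w * (u ^ 2 * Y + u * Y ^ 2 + 1) := by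
    linear_combination (2 + w ^ 3) * hY - (u ^ 2 * Y + u * Y ^ 2 + 1) * hw
  have hu0 : u ≠ 0 := by
    rw [hu]
    simpa using hx
  have hYne : Y ≠ 0 := by
    rintro rfl
    rw [map_zero] at hY1
    exact inv_ne_zero hx hY1.symm
  refine mul_left_cancel₀ (mul_ne_zero hu0 hYne) ?_
  -- `hab` cancels the irrational parts, `hk` turns the rational parts into the term xY of `hq`, and
  -- `hr` supplies 8R(0) = -w(4 + w³).
  linear_combination 16 * w * u * Y * hq - 4 * hab - 8 * (u + Y) * hk + u * Y * w * hr

theorem cubic_series_ne_zero {T : ℚ⟦X⟧} (hT : T = X * (2 + T ^ 3)) : T ≠ 0 := by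
  rintro rfl
  have h2 : (2 + 0 ^ 3 : ℚ⟦X⟧) ≠ 0 := fun h => by
    simpa [map_ofNat] using congrArg constantCoeff h
  exact mul_ne_zero X_ne_zero h2 hT.symm

/-- The closed form of `Q₆(0,0;t)`, without denominators. -/
theorem Q600_closed_form {T : ℚ⟦X⟧} (hT : T = X * (2 + T ^ 3)) :
    8 * X * Q600 = 4 * T - T ^ 4 := by
  obtain ⟨R, hS, hS0, hR⟩ := exists_sqrt_seriesU hT
  have h := congrArg (map (Polynomial.evalRingHom 0)) (Q6x0_closed_form hT hS hS0 hR)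
  have hr := congrArg (map (Polynomial.evalRingHom 0)) hR
  simp only [map_mul, map_add, map_sub, map_pow, map_neg, map_ofNat, map_one, map_X,
    map_evalRingHom_constInX, map_evalRingHom_xVar, map_evalRingHom_Q6x0] at h hr
  have h2 : (2 : ℚ⟦X⟧) ≠ 0 := fun h => by
    simpa [map_ofNat] using congrArg constantCoeff h
  have hT0 : 2 * T ≠ 0 := mul_ne_zero h2 (cubic_series_ne_zero hT)
  refine mul_left_cancel₀ hT0 ?_
  linear_combination h + T * hr

end ClosedForm

/-! ### Algebraicity. -/

section Algebraicity

open PowerSeries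

theorem constInX_injective : Function.Injective constInX := by
  intro f g h
  rw [← map_evalRingHom_constInX f, h, map_evalRingHom_constInX]

theorem isAlgebraic_powerSeries_C {R : Type*} [CommRing R] [Nontrivial R] (r : R) :
    IsAlgebraic R[X] (C r : R⟦X⟧) := by
  have h : (C r : R⟦X⟧) = algebraMap R[X] R⟦X⟧ (Polynomial.C r) := by
    simp [algebraMap_apply']
  rw [h]
  exact isAlgebraic_algebraMap _

theorem isAlgebraic_powerSeries_X {R : Type*} [CommRing R] [Nontrivial R] :
    IsAlgebraic R[X] (X : R⟦X⟧) := by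
  have h : (X : R⟦X⟧) = algebraMap R[X] R⟦X⟧ Polynomial.X := by
    simp [algebraMap_apply']
  rw [h]
  exact isAlgebraic_algebraMap _

theorem xVar_ne_zero : xVar ≠ 0 := by
  intro h
  have hmap := congrArg constantCoeff h
  rw [xVar, constantCoeff_C, map_zero] at hmap
  exact Polynomial.X_ne_zero hmap

/-- Algebraicity of series is preserved by injective changes of coefficients. -/
theorem IsAlgebraic.powerSeries_map {R S : Type*} [CommRing R] [CommRing S] {φ : R →+* S}
    (hφ : Function.Injective φ) {f : R⟦X⟧} (hf : IsAlgebraic R[X] f) :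
    IsAlgebraic S[X] (PowerSeries.map φ f) := by
  refine hf.ringHom_of_comp_eq (Polynomial.mapRingHom φ) (PowerSeries.map φ)
    (Polynomial.map_injective φ hφ) ?_
  ext <;> simp [algebraMap_apply']

theorem isAlgebraic_cubic_series {T : ℚ⟦X⟧} (hT : T = X * (2 + T ^ 3)) :
    IsAlgebraic ℚ[X] T := by
  refine ⟨Polynomial.X - Polynomial.C Polynomial.X * (2 + Polynomial.X ^ 3), ?_, ?_⟩
  · intro h
    have := congrArg (fun p => Polynomial.coeff p 1) h
    simp [Polynomial.coeff_X, Polynomial.coeff_X_pow] at this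
  · have h : algebraMap ℚ[X] ℚ⟦X⟧ Polynomial.X = X := by simp [algebraMap_apply']
    simp only [map_sub, map_mul, map_add, map_pow, map_ofNat, Polynomial.aeval_X,
      Polynomial.aeval_C, h]
    rw [← hT, sub_self]

theorem isAlgebraic_ofNat_of_algebra {R A : Type*} [CommRing R] [IsDomain R] [CommRing A]
    [Algebra R A] (n : ℕ) [n.AtLeastTwo] :
    IsAlgebraic R (OfNat.ofNat n : A) := by
  rw [← map_ofNat (algebraMap R A) n]
  exact isAlgebraic_algebraMap _

section AbstractRelations

variable {R A : Type*} [CommRing R] [IsDomain R] [CommRing A] [IsDomain A] [Algebra R A]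

theorem IsAlgebraic.of_quartic_relation {t τ q : A} (h8 : (8 : A) ≠ 0) (ht0 : t ≠ 0)
    (ht : IsAlgebraic R t) (hτ : IsAlgebraic R τ) (h : 8 * t * q = 4 * τ - τ ^ 4) :
    IsAlgebraic R q := by
  refine IsAlgebraic.of_mul (y := 8 * t) (mem_nonZeroDivisors_of_ne_zero (mul_ne_zero h8 ht0))
    ((isAlgebraic_ofNat_of_algebra 8).mul ht) ?_
  rw [h]
  exact ((isAlgebraic_ofNat_of_algebra 4).mul hτ).sub (hτ.pow 4)

/-- 1 + xr is algebraic because its square is; dividing by x gives r, and dividing by 16tτ gives q.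
-/
theorem IsAlgebraic.of_sqrt_relation {t τ x c r q : A} (h16 : (16 : A) ≠ 0) (ht0 : t ≠ 0)
    (hτ0 : τ ≠ 0) (hx0 : x ≠ 0) (ht : IsAlgebraic R t) (hτ : IsAlgebraic R τ)
    (hx : IsAlgebraic R x) (hc : IsAlgebraic R c)
    (hr : (1 + x * r) ^ 2 = 1 - x * τ * (1 + c * τ ^ 3) + c * (x ^ 2 * τ ^ 2))
    (hq : 16 * t * τ * q = τ ^ 2 * (4 - τ ^ 3) + 8 * (-2 * x + τ ^ 2) * (1 + x * r) +
      8 * τ * r + 8 * (2 + τ ^ 3) * x - 8 * τ * x ^ 2) :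
    IsAlgebraic R q := by
  have hn : ∀ (n : ℕ) [n.AtLeastTwo], IsAlgebraic R (OfNat.ofNat n : A) :=
    isAlgebraic_ofNat_of_algebra
  have hs : IsAlgebraic R (1 + x * r) := by
    refine IsAlgebraic.of_pow (n := 2) two_pos ?_
    rw [hr]
    exact (isAlgebraic_one.sub ((hx.mul hτ).mul (isAlgebraic_one.add (hc.mul
      (hτ.pow 3))))).add (hc.mul ((hx.pow 2).mul (hτ.pow 2)))
  have hralg : IsAlgebraic R r := by
    refine IsAlgebraic.of_mul (mem_nonZeroDivisors_of_ne_zero hx0) hx ?_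
    rw [← add_sub_cancel_left 1 (x * r)]
    exact hs.sub isAlgebraic_one
  refine IsAlgebraic.of_mul (y := 16 * t * τ)
    (mem_nonZeroDivisors_of_ne_zero (mul_ne_zero (mul_ne_zero h16 ht0) hτ0))
    (((hn 16).mul ht).mul hτ) ?_
  rw [hq]
  exact (((((hτ.pow 2).mul ((hn 4).sub (hτ.pow 3))).add
    (((hn 8).mul (((hn 2).neg.mul hx).add (hτ.pow 2))).mul hs)).add
    (((hn 8).mul hτ).mul hralg)).add (((hn 8).mul ((hn 2).add (hτ.pow 3))).mul hx)).sub
    (((hn 8).mul hτ).mul (hx.pow 2))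

theorem IsAlgebraic.of_kernel_relation {t k p f g h q : A} (hk0 : p - t * k ≠ 0)
    (ht : IsAlgebraic R t) (hk : IsAlgebraic R k) (hp : IsAlgebraic R p) (hf : IsAlgebraic R f)
    (hg : IsAlgebraic R g) (hh : IsAlgebraic R h)
    (hq : (p - t * k) * q = p - t * (f + g - h)) : IsAlgebraic R q := by
  refine IsAlgebraic.of_mul (mem_nonZeroDivisors_of_ne_zero hk0) (hp.sub (ht.mul hk)) ?_
  rw [hq]
  exact hp.sub (ht.mul ((hf.add hg).sub hh))

end AbstractRelations

theorem isAlgebraic_Q600 : IsAlgebraic ℚ[X] Q600 := by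
  obtain ⟨T, hT, -⟩ := existsUnique_cubic_series
  have h8 : (8 : ℚ⟦X⟧) ≠ 0 := fun h => by
    simpa [map_ofNat] using congrArg constantCoeff h
  exact IsAlgebraic.of_quartic_relation h8 X_ne_zero isAlgebraic_powerSeries_X
    (isAlgebraic_cubic_series hT) (Q600_closed_form hT)

theorem isAlgebraic_Q6x0 : IsAlgebraic ℚ[X][X] Q6x0 := by
  obtain ⟨T, hT, -⟩ := existsUnique_cubic_series
  obtain ⟨R, hS, hS0, hR⟩ := exists_sqrt_seriesU hT
  have hτ : IsAlgebraic ℚ[X][X] (constInX T) :=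
    (isAlgebraic_cubic_series hT).powerSeries_map Polynomial.C_injective
  have hτ0 : constInX T ≠ 0 := by
    rw [← map_zero (map Polynomial.C)]
    exact constInX_injective.ne (cubic_series_ne_zero hT)
  have h16 : (16 : ℚ[X]⟦X⟧) ≠ 0 := fun h => by
    have := congrArg (Polynomial.eval 0) (congrArg constantCoeff h)
    norm_num [map_ofNat] at this
  exact IsAlgebraic.of_sqrt_relation h16 X_ne_zero hτ0 xVar_ne_zero isAlgebraic_powerSeries_X hτ
    (isAlgebraic_powerSeries_C _) (isAlgebraic_powerSeries_C _) (hS.trans (seriesU_eq T))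
    (Q6x0_closed_form hT hS hS0 hR)

/-- The kernel is nonzero, being xy at t = 0, so the kernel equation can be solved for Q(x,y). -/
theorem isAlgebraic_Q6 : IsAlgebraic (MvPolynomial (Fin 2) ℚ)[X] Q6 := by
  have hinj : ∀ i : Fin 2, Function.Injective (Polynomial.aeval
      (MvPolynomial.X i : MvPolynomial (Fin 2) ℚ) : ℚ[X] →ₐ[ℚ] _).toRingHom := fun i =>
    transcendental_iff_injective.1 (MvPolynomial.transcendental_X ℚ i)
  refine IsAlgebraic.of_kernel_relation ?_ isAlgebraic_powerSeries_X
    (isAlgebraic_powerSeries_C _) (isAlgebraic_powerSeries_C _)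
    (isAlgebraic_Q6x0.powerSeries_map (hinj 0)) (isAlgebraic_Q6x0.powerSeries_map (hinj 1))
    (isAlgebraic_Q600.powerSeries_map (MvPolynomial.C_injective _ _)) kernel_mul_Q6
  intro h
  have := congrArg constantCoeff h
  simp [MvPolynomial.X_ne_zero] at this

end Algebraicity

/-! ### The formula in the field of fractions. -/

theorem mainTheorem1 :
    -- `T = t(2 + T³)` defines a power series `T` in `t`
    (∃! T : ℚ⟦X⟧, T = PowerSeries.X * (2 + T ^ 3)) ∧
    (∀ T : ℚ⟦X⟧, T = PowerSeries.X * (2 + T ^ 3) →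
      -- `U(x)` has a unique square root with constant term `1` in `t`
      (∃! S : ℚ[X]⟦X⟧, S ^ 2 = seriesU T ∧ PowerSeries.constantCoeff S = 1) ∧
      ∀ S : ℚ[X]⟦X⟧, S ^ 2 = seriesU T ∧ PowerSeries.constantCoeff S = 1 →
        ∀ x t τ q₀₀ : SeriesField, x = toField xVar → t = toField PowerSeries.X →
          τ = toField (constInX T) → q₀₀ = toField (constInX Q600) →
          2 * toField Q6x0 = q₀₀
              + ((-2 * x) / (τ * t) * (1 - τ ^ 2 / (2 * x)) + 1 / (t * x)) * toField S
              + (1 - t * x - t / x ^ 2) * x * (t ^ 2)⁻¹ ∧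
          q₀₀ = (4 * τ - τ ^ 4) / (8 * t)) ∧
    -- algebraicity of `Q₆(x,0;t)` and of `Q₆(x,y;t)`
    IsAlgebraic (ℚ[X][X]) Q6x0 ∧
    IsAlgebraic ((MvPolynomial (Fin 2) ℚ)[X]) Q6 := by
  refine ⟨existsUnique_cubic_series, fun T hT => ?_, isAlgebraic_Q6x0, isAlgebraic_Q6⟩
  obtain ⟨R, hR2, hR0, hR⟩ := exists_sqrt_seriesU hT
  have huniq : ∀ S : ℚ[X]⟦X⟧, S ^ 2 = seriesU T ∧ PowerSeries.constantCoeff S = 1 →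
      S = 1 + xVar * R := fun S hS =>
    eq_of_sq_eq_sq_of_constantCoeff (hS.1.trans hR2.symm) hS.2 hR0
  refine ⟨⟨_, ⟨hR2, hR0⟩, huniq⟩, ?_⟩
  rintro S hS x t τ q₀₀ hx ht hτ hq
  have hinj : Function.Injective toField := IsFractionRing.injective _ _
  have hx0 : x ≠ 0 := by
    rw [hx, ← map_zero toField]
    exact hinj.ne xVar_ne_zero
  have ht0 : t ≠ 0 := by
    rw [ht, ← map_zero toField]
    exact hinj.ne PowerSeries.X_ne_zero
  have hτ0 : τ ≠ 0 := by
    rw [hτ, ← map_zero toField, ← map_zero (PowerSeries.map Polynomial.C)]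
    exact hinj.ne (constInX_injective.ne (cubic_series_ne_zero hT))
  have hchar : CharZero SeriesField := algebraRat.charZero _
  have hτt : τ = t * (2 + τ ^ 3) := by
    have h := congrArg toField (constInX_eq_X_mul hT)
    simpa only [map_mul, map_add, map_pow, map_ofNat, ← hτ, ← ht] using h
  have h00 : 8 * t * q₀₀ = 4 * τ - τ ^ 4 := by
    have h := congrArg (PowerSeries.map Polynomial.C) (Q600_closed_form hT)
    simp only [map_mul, map_sub, map_pow, map_ofNat, PowerSeries.map_X] at h
    have hmap := congrArg toField h
    simp only [map_mul, map_sub, map_pow, map_ofNat] at hmap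
    rw [ht, hτ, hq]
    exact hmap
  have hcf := congrArg toField (Q6x0_closed_form hT hR2 hR0 hR)
  rw [← huniq S hS] at hcf
  have hSR : toField S = 1 + x * toField R := by
    rw [huniq S hS, hx, map_add, map_mul, map_one]
  simp only [map_mul, map_add, map_sub, map_pow, map_neg, map_ofNat, ← hτ, ← ht, ← hx] at hcf
  have hquot : q₀₀ = (4 * τ - τ ^ 4) / (8 * t) := by
    rw [eq_div_iff (mul_ne_zero (by norm_num) ht0)]
    linear_combination h00
  refine ⟨?_, hquot⟩
  rw [hquot]
  have hne : 8 * t ^ 2 * τ * x ≠ 0 := by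
    simp [hx0, ht0, hτ0]
  have hclear : 8 * t ^ 2 * τ * x * ((4 * τ - τ ^ 4) / (8 * t)
      + ((-2 * x) / (τ * t) * (1 - τ ^ 2 / (2 * x)) + 1 / (t * x)) * toField S
      + (1 - t * x - t / x ^ 2) * x * (t ^ 2)⁻¹) =
      t * τ * x * (4 * τ - τ ^ 4) + 8 * t * (-2 * x ^ 2 + τ ^ 2 * x + τ) * toField S
        + 8 * τ * (x ^ 2 - t * x ^ 3 - t) := by
    field_simp
    ring
  refine mul_left_cancel₀ hne ?_
  rw [hclear]
  -- `hSR` trades xR for √U - 1, and `hτt` trades t(2 + τ³) for τ.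
  linear_combination t * x * hcf - 8 * τ * t * hSR - 8 * x ^ 2 * hτt
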